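/- A \emph{signed graph} is a finite graph $G$ (loops and parallel edges are allowed) in which every edge is labelled with a sign, $+$ or $-$. An \emph{orientation} of $G$ is obtained by dividing each edge into two half-edges, one at each end of the edge (both at the same vertex for a loop), and directing each half-edge either to or from its end-vertex, in such a way that exactly one of the two half-edges of a positive edge is directed to its end-vertex, while the two half-edges of a negative edge are either both directed to, or both directed from, their end-vertices. A \emph{nowhere-zero integer flow} on $G$ consists of an orientation of $G$ and a function $\varphi\colon E(G)\to\mathbb{Z}\setminus\{0\}$ such that at each vertex $v$ the sum of the values of $\varphi$ over the half-edges directed to $v$ equals the sum over the half-edges directed from $v$. A circuit of $G$ (a loop counts as a circuit of length $1$, and two parallel edges form a circuit of length $2$) is \emph{balanced} if it contains an even number of negative edges, and \emph{unbalanced} otherwise. An \emph{unbalanced bicircuit} of $G$ is a subgraph of $G$ that is either (a) the union of two vertex-disjoint unbalanced circuits and a path joining them that meets each of the circuits only at one of its ends, or (b) the union of two edge-disjoint unbalanced circuits that have exactly one vertex in common. \textbf{Corollary.} A signed graph $G$ admits a nowhere-zero integer flow if and only if each edge of $G$ belongs to a balanced circuit or to an unbalanced bicircuit of $G$. -/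

import Mathlib

open scoped Graph

/-- A signed graph: a multigraph (loops and parallel edges allowed) in which every edge carries a
sign `1` or `-1`. Only the signs of edges in `E(G)` matter. -/
structure SignedGraph (α β : Type*) extends Graph α β where
  /-- The sign of an edge. -/
  sign : β → ℤˣ

/-- The half-edges of `G`: every edge `e` is divided into the half-edges `(e, false)` and
`(e, true)`. -/
abbrev SignedGraph.HalfEdge {α β : Type*} (G : SignedGraph α β) : Type _ :=
  E(G.toGraph) × Bool

/-- An orientation (bidirection) of a signed graph. The two half-edges of an edge `e` are attached
to the two ends of `e` (both to the same vertex if `e` is a loop), and each half-edge is directed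
either to its end-vertex or from it; for a positive edge exactly one half-edge is directed to its
end-vertex, for a negative edge both are or none is. -/
structure Bidirection {α β : Type*} (G : SignedGraph α β) where
  /-- The end-vertex of a half-edge. -/
  halfEnd : G.HalfEdge → α
  /-- The direction of a half-edge: `1` if it is directed to its end-vertex, `-1` if from it. -/
  dir : G.HalfEdge → ℤˣ
  isLink_halfEnd : ∀ e : E(G.toGraph), G.IsLink e (halfEnd (e, false)) (halfEnd (e, true))
  dir_of_pos : ∀ e : E(G.toGraph), G.sign e = 1 → dir (e, false) ≠ dir (e, true)
  dir_of_neg : ∀ e : E(G.toGraph), G.sign e = -1 → dir (e, false) = dir (e, true)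

/-- The half-edges of `G` that are incident with `v` and directed to `v`. -/
def Bidirection.incoming {α β : Type*} {G : SignedGraph α β} (B : Bidirection G) (v : α) :
    Set G.HalfEdge :=
  {h | B.halfEnd h = v ∧ B.dir h = 1}

/-- The half-edges of `G` that are incident with `v` and directed from `v`. -/
def Bidirection.outgoing {α β : Type*} {G : SignedGraph α β} (B : Bidirection G) (v : α) :
    Set G.HalfEdge :=
  {h | B.halfEnd h = v ∧ B.dir h = -1}

/-- `φ`, with respect to the orientation `B`, is an `A`-flow (for `G` with finitely many edges):
at every vertex the sum of incoming values equals the sum of outgoing values. Sums are over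
half-edges, so a loop directed to its vertex at both ends contributes its value twice. -/
def Bidirection.IsFlow {α β A : Type*} [AddCommGroup A] {G : SignedGraph α β}
    (B : Bidirection G) (φ : E(G.toGraph) → A) : Prop :=
  ∀ v ∈ V(G.toGraph), ∑ᶠ h ∈ B.incoming v, φ h.1 = ∑ᶠ h ∈ B.outgoing v, φ h.1

/-- `G` admits a nowhere-zero `A`-flow. -/
def SignedGraph.HasNowhereZeroFlow {α β : Type*} (G : SignedGraph α β) (A : Type*)
    [AddCommGroup A] : Prop :=
  ∃ (B : Bidirection G) (φ : E(G.toGraph) → A), B.IsFlow φ ∧ ∀ e, φ e ≠ 0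

/-- The graph `C` is a circuit: for some `n ≥ 1` its vertices and edges can be listed, each exactly
once, as `v 0, …, v (n - 1)` and `e 0, …, e (n - 1)` so that `e i` joins `v i` to `v (i + 1)`,
indices being read cyclically (`v n = v 0`). A loop is a circuit with `n = 1`, two parallel edges
form a circuit with `n = 2`. -/
def IsCircuit {α β : Type*} (C : Graph α β) : Prop :=
  ∃ (n : ℕ) (v : ℕ → α) (e : ℕ → β), 1 ≤ n ∧ v n = v 0 ∧
    Set.InjOn v (Set.Iio n) ∧ Set.InjOn e (Set.Iio n) ∧
    V(C) = v '' Set.Iio n ∧ E(C) = e '' Set.Iio n ∧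
    ∀ i < n, C.IsLink (e i) (v i) (v (i + 1))

/-- The graph `P` is a path with ends `x` and `y`: its vertices are distinct
`x = v 0, …, v n = y` and its edges are `e 0, …, e (n - 1)`, where `e i` joins `v i` to
`v (i + 1)`. -/
def IsPathBetween {α β : Type*} (P : Graph α β) (x y : α) : Prop :=
  ∃ (n : ℕ) (v : ℕ → α) (e : Fin n → β), v 0 = x ∧ v n = y ∧ Set.InjOn v (Set.Iic n) ∧
    V(P) = v '' Set.Iic n ∧ E(P) = Set.range e ∧
    ∀ i : Fin n, P.IsLink (e i) (v i) (v (i + 1))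

/-- A circuit of `G` (a subgraph of `G`) with an even number of negative edges. -/
def SignedGraph.IsBalancedCircuit {α β : Type*} (G : SignedGraph α β) (C : Graph α β) : Prop :=
  C ≤ G.toGraph ∧ IsCircuit C ∧ Even {e ∈ E(C) | G.sign e = -1}.ncard

/-- A circuit of `G` (a subgraph of `G`) with an odd number of negative edges. -/
def SignedGraph.IsUnbalancedCircuit {α β : Type*} (G : SignedGraph α β) (C : Graph α β) : Prop :=
  C ≤ G.toGraph ∧ IsCircuit C ∧ ¬ Even {e ∈ E(C) | G.sign e = -1}.ncard

/-- The union of two disjoint unbalanced circuits of `G` with a path of `G` that joins them and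
meets them only at its ends. -/
def SignedGraph.IsLongBicircuit {α β : Type*} (G : SignedGraph α β) (U : Graph α β) : Prop :=
  U ≤ G.toGraph ∧ ∃ (C D P : Graph α β) (x y : α),
    G.IsUnbalancedCircuit C ∧ G.IsUnbalancedCircuit D ∧ Disjoint V(C) V(D) ∧
    P ≤ G.toGraph ∧ IsPathBetween P x y ∧ V(P) ∩ V(C) = {x} ∧ V(P) ∩ V(D) = {y} ∧
    V(U) = V(C) ∪ V(D) ∪ V(P) ∧ E(U) = E(C) ∪ E(D) ∪ E(P)

/-- The union of two unbalanced circuits of `G` that have a single vertex, and no edge, in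
common. -/
def SignedGraph.IsTightBicircuit {α β : Type*} (G : SignedGraph α β) (U : Graph α β) : Prop :=
  U ≤ G.toGraph ∧ ∃ (C D : Graph α β) (x : α),
    G.IsUnbalancedCircuit C ∧ G.IsUnbalancedCircuit D ∧
    V(C) ∩ V(D) = {x} ∧ Disjoint E(C) E(D) ∧
    V(U) = V(C) ∪ V(D) ∧ E(U) = E(C) ∪ E(D)

/-- An unbalanced bicircuit of `G`, of either kind. -/
def SignedGraph.IsUnbalancedBicircuit {α β : Type*} (G : SignedGraph α β) (U : Graph α β) :
    Prop :=
  G.IsLongBicircuit U ∨ G.IsTightBicircuit U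

/-!
Fix an orientation. It assigns to an edge `e` joining `u` to `w` the incidence vector
`± (u - sign e • w)` in `α →₀ ℤ`, and an integral flow is a finitely supported `φ : β →₀ ℤ` on the
edges that is killed by the resulting boundary map (`Bidirection.isFlow_iff`).

Sending the value `1` along a trail from `x` to `y`, with a change of sign at each negative edge,
gives a chain with boundary `x - τ • y`, where `τ` is the product of the signs of the trail
(`SignedGraph.exists_chain_of_isTrailSeq`). Hence a balanced circuit is the support of a flow, and
an unbalanced circuit through `x` is the support of a chain with boundary `2 • x`; two such chains
cancel along the path of a bicircuit, or at the common vertex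
(`SignedGraph.IsUnbalancedBicircuit.exists_cycle`). If these subgraphs cover all edges, a suitable
integral combination of their flows vanishes nowhere (`SignedGraph.exists_cycle_subset_support`).

Conversely, the support of a nonzero flow always contains a balanced circuit or an unbalanced
bicircuit (`SignedGraph.IsCycle.exists_subset_support`). The support has no pendant edges, so
following its edges produces a circuit `C`. If `C` is unbalanced, it is not a component of the
support: a potential on `V(C)` whose coboundary vanishes on all edges of `C` but one would force
the flow to vanish on that one. So an edge of the support leaves `C`. Following it produces either
a second circuit, disjoint from `C` up to the vertex where it may be attached, or a path joining
two vertices of `C`; in the latter case one of the two circuits through the path is balanced. If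
the subgraph found misses a given edge `f` of the support, the flow that it carries can be used to
cancel an edge of the support other than `f`, and induction on the size of the support finishes the
proof (`SignedGraph.IsCycle.exists_mem`).
-/

open Finset

section

variable {α β : Type*}

/-! ### Trails and circuits as sequences -/

/-- The edges `e 0, …, e (n - 1)` are distinct and `e i` joins `v i` to `v (i + 1)` in `G`. The
values of `v` beyond `n` and of `e` beyond `n - 1` are irrelevant. -/
structure Graph.IsTrailSeq (G : Graph α β) (n : ℕ) (v : ℕ → α) (e : ℕ → β) : Prop where
  injOn_edge : Set.InjOn e (Set.Iio n)
  isLink : ∀ i < n, G.IsLink (e i) (v i) (v (i + 1))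

/-- A closed trail of length `n ≥ 1` in `G` whose vertices `v 0, …, v (n - 1)` are distinct. -/
structure Graph.IsCircuitSeq (G : Graph α β) (n : ℕ) (v : ℕ → α) (e : ℕ → β) : Prop
    extends G.IsTrailSeq n v e where
  pos : 1 ≤ n
  closed : v n = v 0
  injOn_vertex : Set.InjOn v (Set.Iio n)

namespace Graph

variable {G H : Graph α β} {n m k : ℕ} {v u : ℕ → α} {e d : ℕ → β}

lemma IsTrailSeq.mono (h : H.IsTrailSeq n v e) (hle : H ≤ G) : G.IsTrailSeq n v e :=
  ⟨h.injOn_edge, fun i hi => (h.isLink i hi).mono hle⟩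

lemma IsTrailSeq.segment (h : G.IsTrailSeq n v e) (hk : k + m ≤ n) :
    G.IsTrailSeq m (fun i => v (k + i)) (fun i => e (k + i)) := by
  refine ⟨fun i hi j hj hij => ?_, fun i hi => h.isLink (k + i) (by omega)⟩
  simp only [Set.mem_Iio] at hi hj
  have := h.injOn_edge (Set.mem_Iio.2 (by omega : k + i < n))
    (Set.mem_Iio.2 (by omega : k + j < n)) hij
  omega

lemma IsTrailSeq.take (h : G.IsTrailSeq n v e) (hk : k ≤ n) : G.IsTrailSeq k v e :=
  ⟨h.injOn_edge.mono (Set.Iio_subset_Iio hk), fun i hi => h.isLink i (by omega)⟩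

lemma IsTrailSeq.reverse (h : G.IsTrailSeq n v e) :
    G.IsTrailSeq n (fun i => v (n - i)) (fun i => e (n - 1 - i)) := by
  refine ⟨fun i hi j hj hij => ?_, fun i hi => ?_⟩
  · simp only [Set.mem_Iio] at hi hj
    have := h.injOn_edge (Set.mem_Iio.2 (by omega : n - 1 - i < n))
      (Set.mem_Iio.2 (by omega : n - 1 - j < n)) hij
    omega
  · have := (h.isLink (n - 1 - i) (by omega)).symm
    rwa [show n - 1 - i + 1 = n - i by omega,
      show v (n - 1 - i) = v (n - (i + 1)) by congr 1; omega] at this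

/-- A trail that returns to its vertex `v k`, and repeats no vertex otherwise, closes up a
circuit. -/
lemma IsTrailSeq.isCircuitSeq (h : G.IsTrailSeq n v e) (hv : Set.InjOn v (Set.Iio n))
    (hk : k < n) (hvk : v n = v k) :
    G.IsCircuitSeq (n - k) (fun i => v (k + i)) (fun i => e (k + i)) := by
  refine ⟨h.segment (by omega), by omega, ?_, fun i hi j hj hij => ?_⟩
  · simp [show k + (n - k) = n by omega, hvk]
  · simp only [Set.mem_Iio] at hi hj
    have := hv (Set.mem_Iio.2 (by omega : k + i < n))
      (Set.mem_Iio.2 (by omega : k + j < n)) hij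
    omega

lemma image_concat {γ : Type*} (f g : ℕ → γ) (k n : ℕ) :
    (fun i => if i < k then f i else g (i - k)) '' Set.Iio (k + n) =
      f '' Set.Iio k ∪ g '' Set.Iio n := by
  ext x
  simp only [Set.mem_image, Set.mem_Iio, Set.mem_union]
  constructor
  · rintro ⟨i, hi, rfl⟩
    split_ifs with h
    · exact .inl ⟨i, h, rfl⟩
    · exact .inr ⟨i - k, by omega, rfl⟩
  · rintro (⟨i, hi, rfl⟩ | ⟨i, hi, rfl⟩)
    · exact ⟨i, by omega, by simp [hi]⟩
    · exact ⟨k + i, by omega, by simp⟩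

lemma injOn_concat {γ : Type*} {f g : ℕ → γ} {k n : ℕ} (hf : Set.InjOn f (Set.Iio k))
    (hg : Set.InjOn g (Set.Iio n)) (hfg : ∀ i < k, ∀ j < n, f i ≠ g j) :
    Set.InjOn (fun i => if i < k then f i else g (i - k)) (Set.Iio (k + n)) := by
  intro i hi j hj hij
  simp only [Set.mem_Iio] at hi hj hij
  split_ifs at hij with h1 h2 h2
  · exact hf h1 h2 hij
  · exact absurd hij (hfg _ h1 _ (by omega))
  · exact absurd hij.symm (hfg _ h2 _ (by omega))
  · have := hg (Set.mem_Iio.2 (by omega : i - k < n)) (Set.mem_Iio.2 (by omega : j - k < n)) hij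
    omega

/-- Two trails without repeated vertices, the second from the end of the first back to its start,
form a circuit if they are internally disjoint. -/
lemma IsTrailSeq.concat (h₁ : G.IsTrailSeq k u d) (h₂ : G.IsTrailSeq n v e) (hk : 1 ≤ k)
    (hkv : u k = v 0) (hnu : v n = u 0) (hu : Set.InjOn u (Set.Iio k))
    (hv : Set.InjOn v (Set.Iio n)) (huv : ∀ i < k, ∀ j < n, u i ≠ v j)
    (hde : ∀ i < k, ∀ j < n, d i ≠ e j) :
    G.IsCircuitSeq (k + n) (fun i => if i < k then u i else v (i - k))
      (fun i => if i < k then d i else e (i - k)) where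
  injOn_edge := injOn_concat h₁.injOn_edge h₂.injOn_edge hde
  isLink i hi := by
    rcases lt_trichotomy (i + 1) k with h | h | h
    · simpa [show i < k by omega, h] using h₁.isLink i (by omega)
    · have := h₁.isLink i (by omega)
      rw [h, hkv] at this
      simpa [show i < k by omega, h] using this
    · have := h₂.isLink (i - k) (by omega)
      simpa [show ¬ i < k by omega, show ¬ i + 1 < k by omega,
        show i + 1 - k = i - k + 1 by omega] using this
  pos := by omega
  closed := by simp [hnu, show 0 < k by omega]
  injOn_vertex := injOn_concat hu hv huv

lemma image_rotate {γ : Type*} (f : ℕ → γ) {k n : ℕ} (hk : k ≤ n) :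
    (fun i => f (k + i)) '' Set.Iio (n - k) ∪ f '' Set.Iio k = f '' Set.Iio n := by
  ext y
  simp only [Set.mem_union, Set.mem_image, Set.mem_Iio]
  constructor
  · rintro (⟨i, hi, rfl⟩ | ⟨i, hi, rfl⟩)
    exacts [⟨k + i, by omega, rfl⟩, ⟨i, by omega, rfl⟩]
  · rintro ⟨i, hi, rfl⟩
    by_cases hik : i < k
    · exact .inr ⟨i, hik, rfl⟩
    · exact .inl ⟨i - k, by omega, by rw [show k + (i - k) = i by omega]⟩

/-- A circuit can be listed from any of its vertices. -/
lemma IsCircuitSeq.rotate (h : G.IsCircuitSeq n v e) {x : α} (hx : x ∈ v '' Set.Iio n) :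
    ∃ v' e', G.IsCircuitSeq n v' e' ∧ v' 0 = x ∧ v' '' Set.Iio n = v '' Set.Iio n ∧
      e' '' Set.Iio n = e '' Set.Iio n := by
  obtain ⟨k, hk, rfl⟩ := hx
  rw [Set.mem_Iio] at hk
  have key := (h.segment (k := k) (m := n - k) (by omega)).concat
    (h.toIsTrailSeq.take hk.le) (by omega)
    (by simp [show k + (n - k) = n by omega, h.closed]) (by simp)
    (fun i hi j hj hij => by
      simp only [Set.mem_Iio] at hi hj
      have := h.injOn_vertex (Set.mem_Iio.2 (by omega : k + i < n))
        (Set.mem_Iio.2 (by omega : k + j < n)) hij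
      omega)
    (h.injOn_vertex.mono (Set.Iio_subset_Iio hk.le))
    (fun i hi j hj hij => by
      have := h.injOn_vertex (Set.mem_Iio.2 (by omega : k + i < n))
        (Set.mem_Iio.2 (by omega : j < n)) hij
      omega)
    (fun i hi j hj hij => by
      have := h.injOn_edge (Set.mem_Iio.2 (by omega : k + i < n))
        (Set.mem_Iio.2 (by omega : j < n)) hij
      omega)
  have hv := image_concat (fun i => v (k + i)) v (n - k) k
  have he := image_concat (fun i => e (k + i)) e (n - k) k
  rw [show n - k + k = n by omega] at key hv he
  exact ⟨_, _, key, by simp [hk], hv.trans (image_rotate v hk.le),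
    he.trans (image_rotate e hk.le)⟩

/-- Sets of vertices and edges of `G` form a subgraph as soon as the edges have their ends among
the vertices. -/
lemma exists_le_of_subset (G : Graph α β) (X : Set α) (F : Set β) (hX : X ⊆ V(G))
    (hF : ∀ f ∈ F, ∃ a ∈ X, ∃ b ∈ X, G.IsLink f a b) :
    ∃ C ≤ G, V(C) = X ∧ E(C) = F := by
  refine ⟨{ vertexSet := X
            IsLink := fun f a b => f ∈ F ∧ G.IsLink f a b
            edgeSet := F
            isLink_symm := fun f _ => ⟨fun a b h => ⟨h.1, h.2.symm⟩⟩
            eq_or_eq_of_isLink_of_isLink := fun f a b c d h h' => h.2.left_eq_or_eq h'.2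
            edge_mem_iff_exists_isLink := fun f => ?_
            left_mem_of_isLink := fun f a b h => ?_ }, ⟨hX, fun f a b h => h.2⟩, rfl, rfl⟩
  · refine ⟨fun h => ?_, fun ⟨_, _, h⟩ => h.1⟩
    obtain ⟨a, -, b, -, hab⟩ := hF f h
    exact ⟨a, b, h, hab⟩
  · obtain ⟨c, hc, d, hd, hcd⟩ := hF f h.1
    rcases h.2.left_eq_or_eq hcd with rfl | rfl <;> assumption

lemma IsCircuitSeq.right_mem (h : G.IsCircuitSeq n v e) {i : ℕ} (hi : i < n) :
    v (i + 1) ∈ v '' Set.Iio n := by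
  rcases (show i + 1 ≤ n from hi).lt_or_eq with h' | h'
  · exact ⟨_, h', rfl⟩
  · exact ⟨0, h.pos, by rw [h', h.closed]⟩

lemma IsCircuitSeq.exists_isCircuit (h : G.IsCircuitSeq n v e) :
    ∃ C ≤ G, IsCircuit C ∧ V(C) = v '' Set.Iio n ∧ E(C) = e '' Set.Iio n := by
  obtain ⟨C, hC, hV, hE⟩ := G.exists_le_of_subset (v '' Set.Iio n) (e '' Set.Iio n)
    (by rintro _ ⟨i, hi, rfl⟩; exact (h.isLink i hi).left_mem)
    (by rintro _ ⟨i, hi, rfl⟩; exact ⟨_, ⟨i, hi, rfl⟩, _, h.right_mem hi, h.isLink i hi⟩)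
  refine ⟨C, hC, ⟨n, v, e, h.pos, h.closed, h.injOn_vertex, h.injOn_edge, hV, hE,
    fun i hi => ?_⟩, hV, hE⟩
  exact (hC.isLink_iff (hE ▸ ⟨i, hi, rfl⟩)).2 (h.isLink i hi)

end Graph

lemma IsCircuit.exists_isCircuitSeq {C : Graph α β} (h : IsCircuit C) :
    ∃ n v e, C.IsCircuitSeq n v e ∧ V(C) = v '' Set.Iio n ∧ E(C) = e '' Set.Iio n := by
  obtain ⟨n, v, e, hn, hv, hiv, hie, hV, hE, hl⟩ := h
  exact ⟨n, v, e, ⟨⟨hie, hl⟩, hn, hv, hiv⟩, hV, hE⟩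

/-! ### Boundaries of chains -/

namespace SignedGraph

variable {G : SignedGraph α β} {D : β → α →₀ ℤ}

/-- `D e` is, up to a global sign, the `e`-th column of the incidence matrix of `G`: it equals
`± (u - sign e • w)` if `e` joins `u` to `w`. Thus `Finsupp.linearCombination ℤ D` is the boundary
map on integral chains of edges. -/
def IsIncidence (G : SignedGraph α β) (D : β → α →₀ ℤ) : Prop :=
  ∀ ⦃e u w⦄, G.IsLink e u w →
    ∃ c : ℤˣ, D e = (c : ℤ) • (Finsupp.single u 1 - Finsupp.single w (G.sign e : ℤ))

/-- An integral flow, as a chain of edges of `G` with boundary zero. -/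
def IsCycle (G : SignedGraph α β) (D : β → α →₀ ℤ) (φ : β →₀ ℤ) : Prop :=
  Finsupp.linearCombination ℤ D φ = 0 ∧ (φ.support : Set β) ⊆ E(G.toGraph)

lemma units_mul_self (c : ℤˣ) : (c : ℤ) * c = 1 := by
  rw [← Units.val_mul, Int.units_mul_self, Units.val_one]

/-- The edges of a trail from `x` to `y` support a `± 1`-valued chain with boundary `x - τ • y`,
where `τ` is the sign of the trail: carry the value `1` along, switching its sign at negative
edges. -/
lemma exists_chain_of_isTrailSeq (hD : G.IsIncidence D) {n : ℕ} {v : ℕ → α} {e : ℕ → β}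
    (h : G.IsTrailSeq n v e) :
    ∃ φ : β →₀ ℤ, (φ.support : Set β) = e '' Set.Iio n ∧
      Finsupp.linearCombination ℤ D φ =
        Finsupp.single (v 0) 1 -
          Finsupp.single (v n) ((∏ i ∈ range n, G.sign (e i) : ℤˣ) : ℤ) := by
  classical
  induction n with
  | zero => exact ⟨0, by simp, by simp⟩
  | succ n ih =>
    obtain ⟨φ, hφ, hb⟩ := ih (h.take n.le_succ)
    obtain ⟨c, hc⟩ := hD (h.isLink n (by omega))
    set τ : ℤˣ := ∏ i ∈ range n, G.sign (e i) with hτ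
    have hne : ((τ * c : ℤˣ) : ℤ) ≠ 0 := Units.ne_zero _
    have hen : e n ∉ φ.support := by
      rw [← Finset.mem_coe, hφ]
      rintro ⟨i, hi, hin⟩
      have := h.injOn_edge (Set.mem_Iio.2 (lt_trans hi n.lt_succ_self))
        (Set.mem_Iio.2 n.lt_succ_self) hin
      simp [this] at hi
    refine ⟨φ + Finsupp.single (e n) ((τ * c : ℤˣ) : ℤ), ?_, ?_⟩
    · rw [Finsupp.support_add_eq, Finsupp.support_single _ hne]
      · rw [Finset.coe_union, hφ, Finset.coe_singleton, ← Set.image_singleton, ← Set.image_union]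
        congr 1
        ext i
        simp
      · rw [Finsupp.support_single _ hne]
        simpa using hen
    · have hcc : (τ : ℤ) * c * c = τ := by rw [mul_assoc, units_mul_self, mul_one]
      rw [map_add, hb, Finsupp.linearCombination_single, hc, smul_smul, Units.val_mul, hcc,
        prod_range_succ, ← hτ, smul_sub, Finsupp.smul_single, Finsupp.smul_single]
      simp

/-- The parity of the number of negative edges, read off from the product of the signs. -/
lemma even_ncard_neg_iff (G : SignedGraph α β) {n : ℕ} {e : ℕ → β}
    (he : Set.InjOn e (Set.Iio n)) :
    Even {f ∈ e '' Set.Iio n | G.sign f = -1}.ncard ↔ ∏ i ∈ range n, G.sign (e i) = 1 := by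
  classical
  have h1 : {f ∈ e '' Set.Iio n | G.sign f = -1} =
      e '' ((range n).filter fun i => G.sign (e i) = -1 : Finset ℕ) := by
    ext f
    simp only [Set.mem_image, Set.mem_Iio, Finset.coe_filter, Finset.mem_range]
    constructor
    · rintro ⟨⟨i, hi, rfl⟩, hs⟩
      exact ⟨i, ⟨hi, hs⟩, rfl⟩
    · rintro ⟨i, ⟨hi, hs⟩, rfl⟩
      exact ⟨⟨i, hi, rfl⟩, hs⟩
  have h2 : ∏ i ∈ range n, G.sign (e i) =
      (-1) ^ ((range n).filter fun i => G.sign (e i) = -1).card := by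
    rw [← prod_const, prod_filter]
    refine prod_congr rfl fun i _ => ?_
    rcases Int.units_eq_one_or (G.sign (e i)) with h | h <;> simp [h]
  rw [h1, Set.InjOn.ncard_image (he.mono fun i hi => by
    simpa using (Finset.mem_filter.1 (Finset.mem_coe.1 hi)).1), Set.ncard_coe_finset, h2]
  rcases Nat.even_or_odd ((range n).filter fun i => G.sign (e i) = -1).card with h | h
  · simp [h]
  · simp [h.neg_one_pow, Nat.not_even_iff_odd.2 h]

/-- A balanced circuit is the support of a flow. -/
lemma IsBalancedCircuit.exists_cycle (hD : G.IsIncidence D) {C : Graph α β}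
    (hC : G.IsBalancedCircuit C) :
    ∃ φ : β →₀ ℤ, (φ.support : Set β) = E(C) ∧ Finsupp.linearCombination ℤ D φ = 0 := by
  obtain ⟨hle, hcirc, hev⟩ := hC
  obtain ⟨n, v, e, h, -, hE⟩ := hcirc.exists_isCircuitSeq
  obtain ⟨φ, hφ, hb⟩ := exists_chain_of_isTrailSeq hD (h.toIsTrailSeq.mono hle)
  rw [hE, even_ncard_neg_iff G h.injOn_edge] at hev
  refine ⟨φ, hφ.trans hE.symm, ?_⟩
  rw [hb, hev, h.closed, Units.val_one, sub_self]

/-- An unbalanced circuit through `x` is the support of a chain with boundary `2 • x`. -/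
lemma IsUnbalancedCircuit.exists_chain (hD : G.IsIncidence D) {C : Graph α β}
    (hC : G.IsUnbalancedCircuit C) {x : α} (hx : x ∈ V(C)) :
    ∃ φ : β →₀ ℤ, (φ.support : Set β) = E(C) ∧
      Finsupp.linearCombination ℤ D φ = Finsupp.single x 2 := by
  obtain ⟨hle, hcirc, hev⟩ := hC
  obtain ⟨n, v', e', h', hV, hE⟩ := hcirc.exists_isCircuitSeq
  obtain ⟨v, e, h, rfl, -, he⟩ := h'.rotate (hV ▸ hx)
  obtain ⟨φ, hφ, hb⟩ := exists_chain_of_isTrailSeq hD (h.toIsTrailSeq.mono hle)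
  rw [hE, ← he, even_ncard_neg_iff G h.injOn_edge] at hev
  refine ⟨φ, by rw [hφ, he, hE], ?_⟩
  rw [hb, (Int.units_eq_one_or _).resolve_left hev, h.closed, ← Finsupp.single_sub]
  norm_num

/-- A path from `x` to `y` is the support of a chain with boundary `x ± y`. -/
lemma exists_chain_of_isPathBetween (hD : G.IsIncidence D) {P : Graph α β} {x y : α}
    (hle : P ≤ G.toGraph) (hP : IsPathBetween P x y) :
    ∃ (φ : β →₀ ℤ) (τ : ℤˣ), (φ.support : Set β) = E(P) ∧
      Finsupp.linearCombination ℤ D φ = Finsupp.single x 1 - Finsupp.single y (τ : ℤ) := by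
  obtain ⟨n, v, e, rfl, rfl, hv, -, hE, hl⟩ := hP
  rcases n.eq_zero_or_pos with rfl | hn
  · exact ⟨0, 1, by simp [hE], by simp⟩
  have : NeZero n := ⟨hn.ne'⟩
  let e' : ℕ → β := fun i => e (Fin.ofNat n i)
  have hval : ∀ i < n, ((Fin.ofNat n i : Fin n) : ℕ) = i := fun i hi => Nat.mod_eq_of_lt hi
  have hl' : ∀ i < n, P.IsLink (e' i) (v i) (v (i + 1)) := fun i hi => by
    have := hl (Fin.ofNat n i)
    rwa [hval i hi] at this
  have htrail : P.IsTrailSeq n v e' := by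
    refine ⟨fun i hi j hj hij => ?_, hl'⟩
    rw [Set.mem_Iio] at hi hj
    have h1 := hl' i hi
    rw [hij] at h1
    have hinj : ∀ a ≤ n, ∀ b ≤ n, v a = v b → a = b := fun a ha b hb => hv ha hb
    rcases h1.eq_and_eq_or_eq_and_eq (hl' j hj) with h | h
    · exact hinj _ hi.le _ hj.le h.1
    · have h2 := hinj _ hi.le _ hj h.1
      have h3 := hinj _ hi _ hj.le h.2
      omega
  obtain ⟨φ, hφ, hb⟩ := exists_chain_of_isTrailSeq hD (htrail.mono hle)
  refine ⟨φ, _, ?_, hb⟩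
  rw [hφ, hE]
  ext f
  constructor
  · rintro ⟨i, -, rfl⟩
    exact ⟨_, rfl⟩
  · rintro ⟨i, rfl⟩
    exact ⟨i, i.2, by simp [e']⟩

lemma coe_support_add_eq {φ ψ : β →₀ ℤ}
    (h : Disjoint (φ.support : Set β) (ψ.support : Set β)) :
    ((φ + ψ).support : Set β) = (φ.support : Set β) ∪ (ψ.support : Set β) := by
  classical
  rw [Finsupp.support_add_eq (Finset.disjoint_coe.1 h), Finset.coe_union]

/-- A path and a circuit with a single common vertex have no common edge. -/
lemma disjoint_edgeSet_of_isPathBetween {P C H : Graph α β} {x y z : α} (hP : P ≤ H) (hC : C ≤ H)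
    (h : IsPathBetween P x y) (hz : V(P) ∩ V(C) = {z}) : Disjoint E(P) E(C) := by
  obtain ⟨n, v, e, rfl, rfl, hv, -, hE, hl⟩ := h
  rw [Set.disjoint_left, hE]
  rintro _ ⟨i, rfl⟩ hi
  have h1 := (hC.isLink_iff hi).2 ((hl i).mono hP)
  have h2 : v i ∈ V(P) ∩ V(C) := ⟨(hl i).left_mem, h1.left_mem⟩
  have h3 : v (i + 1) ∈ V(P) ∩ V(C) := ⟨(hl i).right_mem, h1.right_mem⟩
  rw [hz, Set.mem_singleton_iff] at h2 h3
  have := hv (Set.mem_Iic.2 i.2.le) (Set.mem_Iic.2 i.2) (h2.trans h3.symm)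
  omega

/-- Every unbalanced bicircuit is the support of a flow: its circuits have boundaries `2 • x` and
`2 • y`, which cancel each other if `x = y`, and are otherwise cancelled by the value `± 2` along
the path from `x` to `y`. -/
lemma IsUnbalancedBicircuit.exists_cycle (hD : G.IsIncidence D) {U : Graph α β}
    (hU : G.IsUnbalancedBicircuit U) :
    ∃ φ : β →₀ ℤ, (φ.support : Set β) = E(U) ∧ Finsupp.linearCombination ℤ D φ = 0 := by
  rcases hU with ⟨-, C, C', P, x, y, hC, hC', hdisj, hP, hpath, hx, hy, -, hE⟩ |
    ⟨-, C, C', x, hC, hC', hx, hdisj, -, hE⟩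
  · obtain ⟨φ, hφ, hφb⟩ := hC.exists_chain hD (hx.symm.subset rfl).2
    obtain ⟨ψ, hψ, hψb⟩ := hC'.exists_chain hD (hy.symm.subset rfl).2
    obtain ⟨π, τ, hπ, hπb⟩ := exists_chain_of_isPathBetween hD hP hpath
    have hPC := disjoint_edgeSet_of_isPathBetween hP hC.1 hpath hx
    have hPC' := disjoint_edgeSet_of_isPathBetween hP hC'.1 hpath hy
    have hCC' : Disjoint E(C) E(C') := by
      rw [Set.disjoint_left]
      intro f hf hf'
      obtain ⟨a, b, hab⟩ := C.exists_isLink_of_mem_edgeSet hf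
      exact Set.disjoint_left.1 hdisj hab.left_mem
        ((hC'.1.isLink_iff hf').2 (hab.mono hC.1)).left_mem
    have hψ' : (((-τ : ℤ) • ψ).support : Set β) = E(C') := by
      rw [Finsupp.support_smul_eq (by simp), hψ]
    have hπ' : (((-2 : ℤ) • π).support : Set β) = E(P) := by
      rw [Finsupp.support_smul_eq (by norm_num), hπ]
    have hsum : ((φ + (-τ : ℤ) • ψ).support : Set β) = E(C) ∪ E(C') := by
      rw [coe_support_add_eq (by rwa [hφ, hψ']), hφ, hψ']
    refine ⟨φ + (-τ : ℤ) • ψ + (-2 : ℤ) • π, ?_, ?_⟩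
    · rw [coe_support_add_eq (by rw [hsum, hπ']; exact (Set.disjoint_union_left.2
        ⟨hPC.symm, hPC'.symm⟩)), hsum, hπ', hE]
    · rw [map_add, map_add, map_smul, map_smul, hφb, hψb, hπb, smul_sub, Finsupp.smul_single,
        Finsupp.smul_single, Finsupp.smul_single]
      classical
      ext z
      simp only [Finsupp.add_apply, Finsupp.sub_apply, Finsupp.single_apply, Finsupp.zero_apply,
        smul_eq_mul]
      split_ifs <;> ring
  · obtain ⟨φ, hφ, hφb⟩ := hC.exists_chain hD (hx.symm.subset rfl).1
    obtain ⟨ψ, hψ, hψb⟩ := hC'.exists_chain hD (hx.symm.subset rfl).2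
    have hψ' : (((-1 : ℤ) • ψ).support : Set β) = E(C') := by
      rw [Finsupp.support_smul_eq (by norm_num), hψ]
    refine ⟨φ + (-1 : ℤ) • ψ, ?_, ?_⟩
    · rw [coe_support_add_eq (by rwa [hφ, hψ']), hφ, hψ', hE]
    · rw [map_add, map_smul, hφb, hψb]
      simp

/-! ### Circuits in the support of a flow -/

lemma exists_isBalancedCircuit (G : SignedGraph α β) {n : ℕ} {v : ℕ → α} {e : ℕ → β}
    (h : G.IsCircuitSeq n v e) (hs : ∏ i ∈ range n, G.sign (e i) = 1) :
    ∃ C, G.IsBalancedCircuit C ∧ E(C) = e '' Set.Iio n := by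
  obtain ⟨C, hle, hC, -, hE⟩ := h.exists_isCircuit
  exact ⟨C, ⟨hle, hC, by rwa [hE, even_ncard_neg_iff G h.injOn_edge]⟩, hE⟩

lemma exists_isUnbalancedCircuit (G : SignedGraph α β) {n : ℕ} {v : ℕ → α} {e : ℕ → β}
    (h : G.IsCircuitSeq n v e) (hs : ∏ i ∈ range n, G.sign (e i) ≠ 1) :
    ∃ C, G.IsUnbalancedCircuit C ∧ V(C) = v '' Set.Iio n ∧ E(C) = e '' Set.Iio n := by
  obtain ⟨C, hle, hC, hV, hE⟩ := h.exists_isCircuit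
  exact ⟨C, ⟨hle, hC, by rwa [hE, even_ncard_neg_iff G h.injOn_edge]⟩, hV, hE⟩

lemma prod_sign_concat (G : SignedGraph α β) (d e : ℕ → β) (k n : ℕ) :
    ∏ i ∈ range (k + n), G.sign (if i < k then d i else e (i - k)) =
      (∏ i ∈ range k, G.sign (d i)) * ∏ i ∈ range n, G.sign (e i) := by
  rw [prod_range_add]
  congr 1
  · exact prod_congr rfl fun i hi => by rw [if_pos (mem_range.1 hi)]
  · exact prod_congr rfl fun i _ => by simp

/-- An unbalanced circuit together with a path joining two of its vertices contains a balanced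
circuit: the two arcs of the circuit have opposite signs, so that one of them has the sign of the
path. -/
lemma exists_isBalancedCircuit_of_theta (G : SignedGraph α β) {m n k : ℕ} {u v : ℕ → α}
    {d e : ℕ → β} (hC : G.IsCircuitSeq m u d) (hs : ∏ i ∈ range m, G.sign (d i) ≠ 1)
    (hP : G.IsTrailSeq n v e) (hk : 0 < k) (hkm : k < m) (hv0 : v 0 = u 0) (hvn : v n = u k)
    (hv : Set.InjOn v (Set.Iio n)) (hvu : ∀ i, 0 < i → i < n → v i ∉ u '' Set.Iio m)
    (hed : ∀ i < n, e i ∉ d '' Set.Iio m) :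
    ∃ C, G.IsBalancedCircuit C ∧ E(C).Nonempty ∧ E(C) ⊆ d '' Set.Iio m ∪ e '' Set.Iio n := by
  have hu : ∀ i < m, ∀ j < m, u i = u j → i = j := fun i hi j hj h => hC.injOn_vertex hi hj h
  have hd : ∀ i < m, ∀ j < n, d i ≠ e j := fun i hi j hj h => hed j hj ⟨i, hi, h⟩
  have huv : ∀ i < m, ∀ j, 0 < j → j < n → u i ≠ v j := fun i hi j hj hjn h =>
    hvu j hj hjn ⟨i, hi, h⟩
  -- The arc `u 0, …, u k`, closed up by the reversed path.
  have hA := (hC.toIsTrailSeq.take hkm.le).concat hP.reverse hk (by simp [hvn]) (by simp [hv0])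
    (hC.injOn_vertex.mono (Set.Iio_subset_Iio hkm.le))
    (fun i hi j hj hij => by
      simp only [Set.mem_Iio] at hi hj hij
      rcases Nat.eq_zero_or_pos i with rfl | hi0 <;> rcases Nat.eq_zero_or_pos j with rfl | hj0
      · rfl
      · exact absurd (hvn.symm.trans (by simpa using hij)) (huv k hkm _ (by omega) (by omega))
      · exact absurd (hvn.symm.trans (by simpa using hij.symm))
          (huv k hkm _ (by omega) (by omega))
      · have := hv (Set.mem_Iio.2 (by omega : n - i < n)) (Set.mem_Iio.2 (by omega : n - j < n))
          hij
        omega)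
    (fun i hi j hj hij => by
      rcases Nat.eq_zero_or_pos j with rfl | hj0
      · simp only [Nat.sub_zero, hvn] at hij
        have := hu _ (by omega) _ hkm hij
        omega
      · exact huv i (by omega) _ (by omega) (by omega) hij)
    (fun i hi j hj => hd i (by omega) _ (by omega))
  -- The arc `u k, …, u m = u 0`, closed up by the path.
  have hB := (hC.segment (k := k) (m := m - k) (by omega)).concat hP (by omega)
    (by simp [show k + (m - k) = m by omega, hC.closed, hv0]) (by simp [hvn])
    (fun i hi j hj hij => by
      simp only [Set.mem_Iio] at hi hj
      have := hu _ (by omega) _ (by omega) hij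
      omega)
    hv
    (fun i hi j hj hij => by
      rcases Nat.eq_zero_or_pos j with rfl | hj0
      · have := hu _ (by omega) _ (by omega) (hij.trans hv0)
        omega
      · exact huv _ (by omega) _ hj0 hj hij)
    (fun i hi j hj => hd _ (by omega) _ hj)
  have hsA := G.prod_sign_concat d (fun i => e (n - 1 - i)) k n
  have hsB := G.prod_sign_concat (fun i => d (k + i)) e (m - k) n
  rw [prod_range_reflect (fun i => G.sign (e i))] at hsA
  have hsC : ∏ i ∈ range m, G.sign (d i) = (∏ i ∈ range k, G.sign (d i)) *
      ∏ i ∈ range (m - k), G.sign (d (k + i)) := by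
    rw [← prod_range_add, show k + (m - k) = m by omega]
  rw [hsC] at hs
  have hone : (∏ i ∈ range k, G.sign (d i)) * ∏ i ∈ range n, G.sign (e i) = 1 ∨
      (∏ i ∈ range (m - k), G.sign (d (k + i))) * ∏ i ∈ range n, G.sign (e i) = 1 := by
    rcases Int.units_eq_one_or (∏ i ∈ range k, G.sign (d i)) with h1 | h1 <;>
    rcases Int.units_eq_one_or (∏ i ∈ range (m - k), G.sign (d (k + i))) with h2 | h2 <;>
    rcases Int.units_eq_one_or (∏ i ∈ range n, G.sign (e i)) with h3 | h3 <;>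
    simp [h1, h2, h3] at hs ⊢
  rcases hone with h | h
  · obtain ⟨C, hC', hE⟩ := G.exists_isBalancedCircuit hA (hsA.trans h)
    replace hE := hE.trans (Graph.image_concat d (fun i => e (n - 1 - i)) k n)
    refine ⟨C, hC', hE ▸ ⟨d 0, .inl ⟨0, hk, rfl⟩⟩, hE ▸ Set.union_subset_union ?_ ?_⟩
    · exact Set.image_mono (Set.Iio_subset_Iio hkm.le)
    · rintro _ ⟨i, hi, rfl⟩
      rw [Set.mem_Iio] at hi
      exact ⟨n - 1 - i, Set.mem_Iio.2 (by omega), rfl⟩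
  · obtain ⟨C, hC', hE⟩ := G.exists_isBalancedCircuit hB (hsB.trans h)
    replace hE := hE.trans (Graph.image_concat (fun i => d (k + i)) e (m - k) n)
    refine ⟨C, hC', hE ▸ ⟨d k, .inl ⟨0, Set.mem_Iio.2 (by omega), rfl⟩⟩,
      hE ▸ Set.union_subset_union_left _ ?_⟩
    rintro _ ⟨i, hi, rfl⟩
    rw [Set.mem_Iio] at hi
    exact ⟨k + i, Set.mem_Iio.2 (by omega), rfl⟩

/-- Flows are orthogonal to the coboundaries of potentials `p : α → ℤ`: if the coboundary of `p`
vanishes on all but one edge of the support of a flow, it vanishes on that edge as well. -/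
lemma IsCycle.potential_eq (hD : G.IsIncidence D) {φ : β →₀ ℤ} (hφ : G.IsCycle D φ) {f : β}
    (hf : f ∈ φ.support) (p : α → ℤ)
    (hp : ∀ g ∈ φ.support, g ≠ f → ∃ a b, G.IsLink g a b ∧ p a = G.sign g * p b)
    {a b : α} (hab : G.IsLink f a b) : p a = G.sign f * p b := by
  have hpair : ∀ g u w, G.IsLink g u w → ∃ c : ℤˣ,
      Finsupp.linearCombination ℤ p (D g) = c * (p u - G.sign g * p w) := by
    intro g u w h
    obtain ⟨c, hc⟩ := hD h
    exact ⟨c, by rw [hc]; simp⟩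
  have h0 : ∑ g ∈ φ.support, φ g * Finsupp.linearCombination ℤ p (D g) = 0 := by
    have := congrArg (Finsupp.linearCombination ℤ p) hφ.1
    simpa [Finsupp.linearCombination_apply ℤ φ, Finsupp.sum, map_sum] using this
  rw [Finset.sum_eq_single_of_mem f hf] at h0
  · obtain ⟨c, hc⟩ := hpair f a b hab
    rw [hc] at h0
    rcases mul_eq_zero.1 h0 with h | h
    · exact absurd h (Finsupp.mem_support_iff.1 hf)
    · exact sub_eq_zero.1 ((mul_eq_zero.1 h).resolve_left (Units.ne_zero c))
  · intro g hg hgf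
    obtain ⟨u, w, huw, hpw⟩ := hp g hg hgf
    obtain ⟨c, hc⟩ := hpair g u w huw
    rw [hc, hpw, sub_self, mul_zero, mul_zero]

/-- The support of a flow has no pendant edges. -/
lemma IsCycle.exists_ne_inc (hD : G.IsIncidence D) {φ : β →₀ ℤ} (hφ : G.IsCycle D φ) {f : β}
    (hf : f ∈ φ.support) {u w : α} (huw : G.IsLink f u w) (hne : u ≠ w) :
    ∃ g ∈ φ.support, g ≠ f ∧ G.Inc g w := by
  classical
  by_contra! hcon
  have := hφ.potential_eq hD hf (Pi.single w 1) (fun g hg hgf => ?_) huw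
  · rw [Pi.single_eq_of_ne hne, Pi.single_eq_same, mul_one] at this
    exact Units.ne_zero _ this.symm
  · obtain ⟨a, b, hab⟩ := G.exists_isLink_of_mem_edgeSet (hφ.2 hg)
    have ha : a ≠ w := by rintro rfl; exact hcon g hg hgf hab.inc_left
    have hb : b ≠ w := by rintro rfl; exact hcon g hg hgf hab.inc_right
    exact ⟨a, b, hab, by simp [ha, hb]⟩

/-- An unbalanced circuit is never a component of the support of a flow. -/
lemma IsCycle.exists_inc_of_unbalanced (hD : G.IsIncidence D) {φ : β →₀ ℤ} (hφ : G.IsCycle D φ)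
    {n : ℕ} {v : ℕ → α} {e : ℕ → β} (h : G.IsCircuitSeq n v e)
    (hs : ∏ i ∈ range n, G.sign (e i) ≠ 1) (he : ∀ i < n, e i ∈ φ.support) :
    ∃ g ∈ φ.support, g ∉ e '' Set.Iio n ∧ ∃ x ∈ v '' Set.Iio n, G.Inc g x := by
  classical
  by_contra! hcon
  have hn := h.pos
  set τ : ℕ → ℤˣ := fun j => ∏ i ∈ range j, G.sign (e i) with hτ
  have hτs : ∀ i, (τ i : ℤ) = G.sign (e i) * τ (i + 1) := fun i => by
    simp only [hτ, prod_range_succ, Units.val_mul]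
    rw [mul_left_comm, units_mul_self, mul_one]
  -- The potential that makes the coboundary vanish on all edges of the circuit but the last.
  let p : α → ℤ := fun x =>
    if x ∈ v '' Set.Iio n then (τ (Function.invFunOn v (Set.Iio n) x) : ℤ) else 0
  have hpv : ∀ i < n, p (v i) = τ i := fun i hi => by
    simp only [p, if_pos (Set.mem_image_of_mem v (Set.mem_Iio.2 hi))]
    rw [h.injOn_vertex.leftInvOn_invFunOn (Set.mem_Iio.2 hi)]
  have hlast := hφ.potential_eq hD (he (n - 1) (by omega)) p (fun g hg hgf => ?_)
    (h.isLink (n - 1) (by omega))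
  · rw [show n - 1 + 1 = n by omega, h.closed, hpv _ (by omega), hpv 0 (by omega), hτs,
      show n - 1 + 1 = n by omega] at hlast
    have h1 := mul_left_cancel₀ (Units.ne_zero (G.sign (e (n - 1)))) hlast
    exact hs (by simpa [hτ] using Units.val_injective h1)
  · by_cases hgC : g ∈ e '' Set.Iio n
    · obtain ⟨i, hi, rfl⟩ := hgC
      rw [Set.mem_Iio] at hi
      have hin : i + 1 < n := by
        rcases (show i + 1 ≤ n from hi).lt_or_eq with h' | h'
        · exact h'
        · exact absurd (by rw [← h']; simp) hgf
      exact ⟨_, _, h.isLink i hi, by rw [hpv i hi, hpv _ hin, hτs]⟩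
    · obtain ⟨a, b, hab⟩ := G.exists_isLink_of_mem_edgeSet (hφ.2 hg)
      have ha : a ∉ v '' Set.Iio n := fun ha => hcon g hg hgC a ha hab.inc_left
      have hb : b ∉ v '' Set.Iio n := fun hb => hcon g hg hgC b hb hab.inc_right
      exact ⟨a, b, hab, by simp only [p, if_neg ha, if_neg hb, mul_zero]⟩

end SignedGraph

/-- In a finite set of edges without pendant edges, every edge from `x` starts a trail that repeats
no vertex until it either enters `X` or returns to one of its own vertices. -/
lemma Graph.exists_lasso (G : Graph α β) (S : Finset β) (X : Set α)
    (hS : ∀ f ∈ S, ∀ u w, G.IsLink f u w → u ≠ w → ∃ g ∈ S, g ≠ f ∧ G.Inc g w)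
    {f : β} (hf : f ∈ S) {x y : α} (hxy : G.IsLink f x y) :
    ∃ n v e, 1 ≤ n ∧ v 0 = x ∧ e 0 = f ∧ G.IsTrailSeq n v e ∧ Set.InjOn v (Set.Iio n) ∧
      (∀ i < n, e i ∈ S) ∧ (∀ i, 0 < i → i < n → v i ∉ X) ∧
      (v n ∈ X ∨ ∃ k < n, v n = v k) := by
  classical
  by_contra! hcon
  have key : ∀ n, 1 ≤ n → ∃ v e, v 0 = x ∧ e 0 = f ∧ G.IsTrailSeq n v e ∧
      Set.InjOn v (Set.Iio n) ∧ (∀ i < n, e i ∈ S) ∧ (∀ i, 0 < i → i < n → v i ∉ X) := by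
    intro n hn
    induction n, hn using Nat.le_induction with
    | base =>
      refine ⟨fun i => if i = 0 then x else y, fun _ => f, by simp, rfl, ⟨?_, ?_⟩, ?_, ?_, ?_⟩
      · intro i hi j hj _; simp at hi hj; omega
      · intro i hi
        obtain rfl : i = 0 := by omega
        simpa using hxy
      · intro i hi j hj _; simp at hi hj; omega
      · exact fun _ _ => hf
      · intro i h0 h1; omega
    | succ n hn ih =>
      obtain ⟨v, e, hv0, he0, ht, hv, heS, hvX⟩ := ih
      obtain ⟨hnX, hnv⟩ := hcon n v e hn hv0 he0 ht hv heS hvX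
      have hl := ht.isLink (n - 1) (by omega)
      rw [show n - 1 + 1 = n by omega] at hl
      obtain ⟨g, hg, hgne, z, hz⟩ := hS _ (heS (n - 1) (by omega)) _ _ hl
        (hnv _ (by omega)).symm
      -- An earlier edge `e i` has both ends among `v 0, …, v n`, and `v n` only if `i = n - 1`.
      have hgi : ∀ i < n, e i ≠ g := by
        rintro i hi rfl
        rcases hz.left_eq_or_eq (ht.isLink i hi) with h | h
        · exact hnv i hi h
        · rcases (show i + 1 ≤ n from hi).lt_or_eq with h' | h'
          · exact hnv _ h' h
          · exact hgne (by rw [← h']; simp)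
      refine ⟨fun i => if i ≤ n then v i else z, fun i => if i < n then e i else g, by simpa,
        by simpa [show 0 < n by omega], ⟨?_, ?_⟩, ?_, ?_, ?_⟩
      · intro i hi j hj hij
        simp only [Set.mem_Iio] at hi hj hij
        split_ifs at hij with h1 h2 h2
        · exact ht.injOn_edge h1 h2 hij
        · exact absurd hij (hgi _ h1)
        · exact absurd hij.symm (hgi _ h2)
        · omega
      · intro i hi
        rcases Nat.lt_succ_iff_lt_or_eq.1 hi with h | rfl
        · simpa [h, h.le, show i + 1 ≤ n by omega] using ht.isLink i h
        · simpa using hz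
      · intro i hi j hj hij
        simp only [Set.mem_Iio] at hi hj hij
        rw [if_pos (by omega), if_pos (by omega)] at hij
        rcases Nat.lt_succ_iff_lt_or_eq.1 hi with h | rfl <;>
        rcases Nat.lt_succ_iff_lt_or_eq.1 hj with h' | rfl
        · exact hv h h' hij
        · exact absurd hij.symm (hnv _ h)
        · exact absurd hij (hnv _ h')
        · rfl
      · intro i _
        simp only
        split_ifs with h
        exacts [heS i h, hg]
      · intro i h0 h1
        simp only [if_pos (show i ≤ n by omega)]
        rcases Nat.lt_succ_iff_lt_or_eq.1 h1 with h | rfl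
        exacts [hvX i h0 h, hnX]
  obtain ⟨v, e, -, -, ht, -, heS, -⟩ := key (S.card + 1) (by omega)
  have := Finset.card_le_card_of_injOn (s := range (S.card + 1)) (t := S) e
    (fun i hi => heS i (by simpa using hi)) (ht.injOn_edge.mono fun i hi => by simpa using hi)
  simp at this

namespace SignedGraph

variable {G : SignedGraph α β} {D : β → α →₀ ℤ}

/-- The support of a nonzero flow contains a balanced circuit or an unbalanced bicircuit. If the
first circuit met by following edges of the support is unbalanced, some edge of the support leaves
it, and following that edge until a vertex is repeated produces a second circuit connected to the
first one, or a path between two vertices of the first one. -/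
lemma IsCycle.exists_subset_support (hD : G.IsIncidence D) {φ : β →₀ ℤ} (hφ : G.IsCycle D φ)
    (h0 : φ ≠ 0) :
    ∃ U : Graph α β, (G.IsBalancedCircuit U ∨ G.IsUnbalancedBicircuit U) ∧ E(U).Nonempty ∧
      E(U) ⊆ φ.support := by
  have hS : ∀ f ∈ φ.support, ∀ u w, G.IsLink f u w → u ≠ w →
      ∃ g ∈ φ.support, g ≠ f ∧ G.Inc g w := fun f hf u w h hne => hφ.exists_ne_inc hD hf h hne
  obtain ⟨f, hf⟩ := Finsupp.support_nonempty_iff.2 h0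
  obtain ⟨x, y, hxy⟩ := G.exists_isLink_of_mem_edgeSet (hφ.2 hf)
  obtain ⟨n, v, e, hn, -, -, ht, hv, heS, -, hk | ⟨k, hk, hnk⟩⟩ :=
    G.exists_lasso φ.support ∅ hS hf hxy
  · exact absurd hk (Set.notMem_empty _)
  have hC₀ := ht.isCircuitSeq hv hk hnk
  by_cases hs₀ : ∏ i ∈ range (n - k), G.sign (e (k + i)) = 1
  · obtain ⟨C, hC, hE⟩ := G.exists_isBalancedCircuit hC₀ hs₀
    refine ⟨C, .inl hC, hE ▸ ⟨_, 0, hC₀.pos, rfl⟩, ?_⟩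
    rw [hE]
    rintro _ ⟨i, hi, rfl⟩
    rw [Set.mem_Iio] at hi
    exact heS _ (by omega)
  have he₀ : ∀ i < n - k, e (k + i) ∈ φ.support := fun i hi => heS _ (by omega)
  obtain ⟨g, hg, hgC, x', hx', y', hxy'⟩ := hφ.exists_inc_of_unbalanced hD hC₀ hs₀ he₀
  obtain ⟨u, d, hC, hu0, hV, hE⟩ := hC₀.rotate hx'
  rw [← hE] at hgC
  have hs : ∏ i ∈ range (n - k), G.sign (d i) ≠ 1 := by
    rwa [Ne, ← even_ncard_neg_iff G hC.injOn_edge, hE, even_ncard_neg_iff G hC₀.injOn_edge]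
  have hdS : d '' Set.Iio (n - k) ⊆ φ.support := by
    rw [hE]; rintro _ ⟨i, hi, rfl⟩; exact he₀ i hi
  clear hE hV he₀ hs₀ hC₀ hnk hv heS ht hx'
  generalize n - k = m at *
  clear! n v e k
  subst hu0
  obtain ⟨n, v, e, hn, hv0, rfl, ht, hv, heS, hvX, hend⟩ :=
    G.exists_lasso φ.support (u '' Set.Iio m) hS hg hxy'
  have hend_mem : ∀ j < m, ∀ a b, G.IsLink (d j) a b → a ∈ u '' Set.Iio m := by
    intro j hj a b hab
    rcases hab.left_eq_or_eq (hC.isLink j hj) with rfl | rfl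
    exacts [⟨j, hj, rfl⟩, hC.right_mem hj]
  have hed : ∀ i < n, e i ∉ d '' Set.Iio m := by
    rintro i hi ⟨j, hj, hji⟩
    rcases Nat.eq_zero_or_pos i with rfl | hi0
    · exact hgC ⟨j, hj, hji⟩
    · exact hvX i hi0 hi (hend_mem j hj _ _ (hji ▸ ht.isLink i hi))
  have heS' : e '' Set.Iio n ⊆ φ.support := by rintro _ ⟨i, hi, rfl⟩; exact heS i hi
  have hu0 : u 0 ∈ u '' Set.Iio m := ⟨0, hC.pos, rfl⟩
  by_cases hret : ∃ k < n, v n = v k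
  · obtain ⟨k, hk, hnk⟩ := hret
    have hC' := ht.isCircuitSeq hv hk hnk
    have hE' : (fun i => e (k + i)) '' Set.Iio (n - k) ⊆ e '' Set.Iio n := by
      rintro _ ⟨i, hi, rfl⟩
      rw [Set.mem_Iio] at hi
      exact ⟨k + i, Set.mem_Iio.2 (by omega), rfl⟩
    by_cases hs' : ∏ i ∈ range (n - k), G.sign (e (k + i)) = 1
    · obtain ⟨C, hCb, hE⟩ := G.exists_isBalancedCircuit hC' hs'
      exact ⟨C, .inl hCb, hE ▸ ⟨_, 0, hC'.pos, rfl⟩, hE ▸ hE'.trans heS'⟩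
    obtain ⟨A, hA, hVA, hEA⟩ := G.exists_isUnbalancedCircuit hC hs
    obtain ⟨B, hB, hVB, hEB⟩ := G.exists_isUnbalancedCircuit hC' hs'
    have hAne : E(A).Nonempty := hEA ▸ ⟨_, 0, hC.pos, rfl⟩
    have hdisj : Disjoint E(A) E(B) := by
      rw [hEA, hEB, Set.disjoint_right]
      rintro _ ⟨i, hi, rfl⟩
      rw [Set.mem_Iio] at hi
      exact hed _ (by omega)
    have hends : ∀ {H : Graph α β}, H ≤ G.toGraph → ∀ f ∈ E(H),
        ∃ a ∈ V(H), ∃ b ∈ V(H), G.IsLink f a b := by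
      intro H hH f hf
      obtain ⟨a, b, hab⟩ := H.exists_isLink_of_mem_edgeSet hf
      exact ⟨a, hab.left_mem, b, hab.right_mem, hab.mono hH⟩
    rcases Nat.eq_zero_or_pos k with rfl | hk0
    · -- The second circuit returns to the vertex it left the first one from.
      obtain ⟨U, hU, hVU, hEU⟩ := G.exists_le_of_subset (V(A) ∪ V(B)) (E(A) ∪ E(B))
        (Set.union_subset hA.1.vertexSet_mono hB.1.vertexSet_mono) (by
          rintro f (hf | hf)
          · obtain ⟨a, ha, b, hb, hab⟩ := hends hA.1 f hf
            exact ⟨a, .inl ha, b, .inl hb, hab⟩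
          · obtain ⟨a, ha, b, hb, hab⟩ := hends hB.1 f hf
            exact ⟨a, .inr ha, b, .inr hb, hab⟩)
      refine ⟨U, .inr (.inr ⟨hU, A, B, u 0, hA, hB, ?_, hdisj, hVU, hEU⟩),
        hEU ▸ hAne.inl, ?_⟩
      · rw [hVA, hVB]
        apply Set.Subset.antisymm
        · rintro _ ⟨hz, i, hi, rfl⟩
          rcases Nat.eq_zero_or_pos i with rfl | hi0
          · simpa using hv0
          · simp only [zero_add] at hz
            rw [Set.mem_Iio] at hi
            exact absurd hz (hvX i hi0 (by omega))
        · rintro _ rfl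
          exact ⟨hu0, 0, Set.mem_Iio.2 (by omega), by simpa using hv0⟩
      · rw [hEU, hEA, hEB]
        exact Set.union_subset hdS (hE'.trans heS')
    · -- The trail up to the first visit to `v k` is a path joining the two circuits.
      obtain ⟨P, hP, hVP, hEP⟩ := G.exists_le_of_subset (v '' Set.Iic k)
        (Set.range fun i : Fin k => e i)
        (by
          rintro _ ⟨i, hi, rfl⟩
          rw [Set.mem_Iic] at hi
          exact (ht.isLink i (by omega)).left_mem)
        (by
          rintro _ ⟨i, rfl⟩
          exact ⟨_, ⟨i, i.2.le, rfl⟩, _, ⟨i + 1, i.2, rfl⟩, ht.isLink i (i.2.trans hk)⟩)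
      have hpath : IsPathBetween P (u 0) (v k) := by
        refine ⟨k, v, fun i => e i, hv0, rfl, hv.mono fun i hi => ?_, hVP, hEP, fun i => ?_⟩
        · exact lt_of_le_of_lt (Set.mem_Iic.1 hi) hk
        · exact (hP.isLink_iff (hEP ▸ ⟨i, rfl⟩)).2 (ht.isLink i (i.2.trans hk))
      obtain ⟨U, hU, hVU, hEU⟩ := G.exists_le_of_subset (V(A) ∪ V(B) ∪ V(P))
        (E(A) ∪ E(B) ∪ E(P))
        (Set.union_subset (Set.union_subset hA.1.vertexSet_mono hB.1.vertexSet_mono)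
          hP.vertexSet_mono) (by
          rintro f ((hf | hf) | hf)
          · obtain ⟨a, ha, b, hb, hab⟩ := hends hA.1 f hf
            exact ⟨a, .inl (.inl ha), b, .inl (.inl hb), hab⟩
          · obtain ⟨a, ha, b, hb, hab⟩ := hends hB.1 f hf
            exact ⟨a, .inl (.inr ha), b, .inl (.inr hb), hab⟩
          · obtain ⟨a, ha, b, hb, hab⟩ := hends hP f hf
            exact ⟨a, .inr ha, b, .inr hb, hab⟩)
      refine ⟨U, .inr (.inl ⟨hU, A, B, P, u 0, v k, hA, hB, ?_, hP, hpath, ?_, ?_, hVU, hEU⟩),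
        hEU ▸ hAne.inl.inl, ?_⟩
      · rw [hVA, hVB, Set.disjoint_right]
        rintro _ ⟨i, hi, rfl⟩
        rw [Set.mem_Iio] at hi
        exact hvX _ (by omega) (by omega)
      · rw [hVA, hVP]
        apply Set.Subset.antisymm
        · rintro _ ⟨⟨i, hi, rfl⟩, hz⟩
          rw [Set.mem_Iic] at hi
          rcases Nat.eq_zero_or_pos i with rfl | hi0
          · exact hv0
          · exact absurd hz (hvX i hi0 (by omega))
        · rintro _ rfl
          exact ⟨⟨0, Set.mem_Iic.2 (by omega), hv0⟩, hu0⟩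
      · rw [hVB, hVP]
        apply Set.Subset.antisymm
        · rintro _ ⟨⟨i, hi, rfl⟩, j, hj, hij⟩
          rw [Set.mem_Iic] at hi
          rw [Set.mem_Iio] at hj
          have := hv (Set.mem_Iio.2 (by omega : k + j < n)) (Set.mem_Iio.2 (by omega : i < n)) hij
          obtain rfl : i = k := by omega
          rfl
        · rintro _ rfl
          exact ⟨⟨k, Set.mem_Iic.2 le_rfl, rfl⟩, 0, Set.mem_Iio.2 (by omega), by simp⟩
      · rw [hEU, hEA, hEB, hEP]
        refine Set.union_subset (Set.union_subset hdS (hE'.trans heS')) ?_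
        rintro _ ⟨i, rfl⟩
        exact heS _ (i.2.trans hk)
  · obtain ⟨k, hk, hkn⟩ := hend.resolve_right hret
    push Not at hret
    have hk0 : 0 < k := Nat.pos_of_ne_zero (by
      rintro rfl
      exact hret 0 (by omega) (hkn.symm.trans hv0.symm))
    obtain ⟨C, hCb, hne, hsub⟩ := G.exists_isBalancedCircuit_of_theta hC hs ht hk0 hk hv0 hkn.symm
      hv hvX hed
    exact ⟨C, .inl hCb, hne, hsub.trans (Set.union_subset hdS heS')⟩

/-- Every edge in the support of a flow lies in a balanced circuit or an unbalanced bicircuit. If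
the one found in the support avoids the edge, a multiple of the flow it supports can be used to
shrink the support without losing the edge. -/
lemma IsCycle.exists_mem (hD : G.IsIncidence D) {φ : β →₀ ℤ} (hφ : G.IsCycle D φ) {f : β}
    (hf : f ∈ φ.support) :
    ∃ U : Graph α β, f ∈ E(U) ∧ (G.IsBalancedCircuit U ∨ G.IsUnbalancedBicircuit U) := by
  classical
  induction hN : φ.support.card using Nat.strong_induction_on generalizing φ with
  | _ N ih =>
    subst hN
    obtain ⟨U, hU, ⟨g, hg⟩, hsub⟩ := hφ.exists_subset_support hD
      (Finsupp.support_nonempty_iff.1 ⟨f, hf⟩)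
    by_cases hfU : f ∈ E(U)
    · exact ⟨U, hfU, hU⟩
    obtain ⟨ψ, hψ, hψb⟩ := hU.elim (fun h => h.exists_cycle hD) fun h => h.exists_cycle hD
    have hψf : ψ f = 0 := by rwa [← Finsupp.notMem_support_iff, ← Finset.mem_coe, hψ]
    have hψg : ψ g ≠ 0 := by rwa [← Finsupp.mem_support_iff, ← Finset.mem_coe, hψ]
    have hψS : ψ.support ⊆ φ.support := by rw [← Finset.coe_subset, hψ]; exact hsub
    let χ : β →₀ ℤ := ψ g • φ - φ g • ψ
    have hχ : χ.support ⊆ φ.support.erase g := fun h hh => by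
      have hh' : ψ g * φ h - φ g * ψ h ≠ 0 := by
        simpa [χ] using Finsupp.mem_support_iff.1 hh
      refine Finset.mem_erase.2 ⟨?_, ?_⟩
      · rintro rfl
        exact hh' (by ring)
      · by_contra hn
        have h1 := Finsupp.notMem_support_iff.1 hn
        have h2 := Finsupp.notMem_support_iff.1 fun h' => hn (hψS h')
        exact hh' (by rw [h1, h2]; ring)
    refine ih _ (lt_of_le_of_lt (Finset.card_le_card hχ)
      (Finset.card_erase_lt_of_mem (hsub hg))) (φ := χ) ⟨?_, ?_⟩ ?_ rfl
    · simp only [χ, map_sub, map_smul, hφ.1, hψb, smul_zero, sub_zero]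
    · exact fun h hh => hφ.2 (Finset.mem_of_mem_erase (hχ hh))
    · have hφf := Finsupp.mem_support_iff.1 hf
      simp [χ, hψf, hψg, hφf]

/-! ### Combining flows -/

/-- Integral flows can be combined so that no edge in the support of one of them is lost. -/
lemma exists_cycle_subset_support (T : Finset β)
    (hT : ∀ f ∈ T, ∃ φ : β →₀ ℤ, G.IsCycle D φ ∧ f ∈ φ.support) :
    ∃ φ : β →₀ ℤ, G.IsCycle D φ ∧ T ⊆ φ.support := by
  classical
  induction T using Finset.induction_on with
  | empty => exact ⟨0, ⟨by simp, by simp⟩, by simp⟩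
  | insert f T _ ih =>
    obtain ⟨φ, hφ, hφT⟩ := ih fun g hg => hT g (Finset.mem_insert_of_mem hg)
    obtain ⟨ψ, hψ, hψf⟩ := hT f (Finset.mem_insert_self f T)
    by_cases hf : f ∈ φ.support
    · exact ⟨φ, hφ, Finset.insert_subset hf hφT⟩
    -- The factor exceeds all absolute values of `ψ`, so `ψ` cannot cancel a nonzero multiple of it.
    let N : ℤ := 1 + ∑ g ∈ ψ.support, |ψ g|
    have hN : ∀ g, |ψ g| < N := fun g => by
      by_cases hg : g ∈ ψ.support
      · have := Finset.single_le_sum (f := fun g => |ψ g|) (fun _ _ => abs_nonneg _) hg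
        simp only [N]
        linarith
      · have : 0 ≤ ∑ g ∈ ψ.support, |ψ g| := Finset.sum_nonneg fun _ _ => abs_nonneg _
        rw [Finsupp.notMem_support_iff.1 hg, abs_zero]
        simp only [N]
        linarith
    refine ⟨N • φ + ψ, ⟨?_, ?_⟩, Finset.insert_subset ?_ fun g hg => ?_⟩
    · rw [map_add, map_smul, hφ.1, hψ.1, smul_zero, zero_add]
    · intro g hg
      rcases Finset.mem_union.1 (Finsupp.support_add hg) with h | h
      · exact hφ.2 (Finsupp.support_smul h)
      · exact hψ.2 h
    · have h1 := Finsupp.notMem_support_iff.1 hf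
      have h2 := Finsupp.mem_support_iff.1 hψf
      simp [h1, h2]
    · rw [Finsupp.mem_support_iff]
      intro h
      have h1 : |ψ g| = |N| * |φ g| := by
        rw [← abs_mul, ← abs_neg (N * φ g)]
        congr 1
        simp only [Finsupp.add_apply, Finsupp.smul_apply, smul_eq_mul] at h
        linarith
      have h2 : 1 ≤ |φ g| := Int.one_le_abs (Finsupp.mem_support_iff.1 (hφT hg))
      have h3 := hN g
      have h4 : N ≤ |N| := le_abs_self N
      nlinarith [abs_nonneg N]

end SignedGraph

/-! ### Bidirections and flows -/

/-- The incidence vector of an edge: the sum of the ends of its half-edges, each with the sign of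
its direction. Elements of `β` that are not edges get the value zero. -/
noncomputable def Bidirection.incidence {G : SignedGraph α β} (B : Bidirection G) (e : β) :
    α →₀ ℤ :=
  open scoped Classical in
  if h : e ∈ E(G.toGraph) then
    ∑ b : Bool, Finsupp.single (B.halfEnd (⟨e, h⟩, b)) (B.dir (⟨e, h⟩, b) : ℤ)
  else 0

lemma Bidirection.isIncidence {G : SignedGraph α β} (B : Bidirection G) :
    G.IsIncidence B.incidence := by
  intro e u w h
  have he : e ∈ E(G.toGraph) := h.edge_mem
  have hsign : (B.dir (⟨e, he⟩, true) : ℤ) = -(G.sign e * B.dir (⟨e, he⟩, false)) := by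
    have h1 := B.dir_of_pos ⟨e, he⟩
    have h2 := B.dir_of_neg ⟨e, he⟩
    rcases Int.units_eq_one_or (G.sign e) with hs | hs <;>
    rcases Int.units_eq_one_or (B.dir (⟨e, he⟩, true)) with ht | ht <;>
    rcases Int.units_eq_one_or (B.dir (⟨e, he⟩, false)) with hf | hf <;>
    simp_all
  have hD : B.incidence e = Finsupp.single (B.halfEnd (⟨e, he⟩, true))
      (B.dir (⟨e, he⟩, true) : ℤ) + Finsupp.single (B.halfEnd (⟨e, he⟩, false))
      (B.dir (⟨e, he⟩, false) : ℤ) := by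
    simp [Bidirection.incidence, he]
  have hss := SignedGraph.units_mul_self (G.sign e)
  set c := B.dir (⟨e, he⟩, false) with hc
  rcases (B.isLink_halfEnd ⟨e, he⟩).eq_and_eq_or_eq_and_eq h with ⟨h1, h2⟩ | ⟨h1, h2⟩
  · refine ⟨c, ?_⟩
    rw [hD, h1, h2, hsign, smul_sub, Finsupp.smul_single, Finsupp.smul_single, Finsupp.single_neg,
      smul_eq_mul, smul_eq_mul, mul_one, mul_comm (G.sign e : ℤ)]
    abel
  · refine ⟨-(c * G.sign e), ?_⟩
    have h3 : ((-(c * G.sign e) : ℤˣ) : ℤ) * G.sign e = -(c : ℤ) := by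
      push_cast
      rw [neg_mul, mul_assoc, hss, mul_one]
    rw [hD, h1, h2, hsign, smul_sub, Finsupp.smul_single, Finsupp.smul_single, smul_eq_mul,
      smul_eq_mul, h3, Finsupp.single_neg, Finsupp.single_neg, mul_one]
    push_cast
    rw [Finsupp.single_neg, mul_comm (G.sign e : ℤ)]
    abel

lemma SignedGraph.nonempty_bidirection (G : SignedGraph α β) : Nonempty (Bidirection G) := by
  choose a b hab using fun e : E(G.toGraph) => G.exists_isLink_of_mem_edgeSet e.2
  exact ⟨{
    halfEnd := fun h => if h.2 then b h.1 else a h.1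
    dir := fun h => if h.2 then -G.sign h.1 else 1
    isLink_halfEnd := fun e => by simpa using hab e
    dir_of_pos := fun e he => by simp [he]
    dir_of_neg := fun e he => by simp [he] }⟩

/-- Kirchhoff's law in terms of the boundary map. -/
lemma Bidirection.isFlow_iff {G : SignedGraph α β} (B : Bidirection G)
    (hE : E(G.toGraph).Finite) (ψ : β →₀ ℤ) (hψ : (ψ.support : Set β) ⊆ E(G.toGraph)) :
    B.IsFlow (fun e => ψ e) ↔ Finsupp.linearCombination ℤ B.incidence ψ = 0 := by
  classical
  have : Fintype E(G.toGraph) := hE.fintype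
  have hbd : ∀ v, Finsupp.linearCombination ℤ B.incidence ψ v =
      ∑ h : G.HalfEdge, if B.halfEnd h = v then (B.dir h : ℤ) * ψ h.1 else 0 := by
    intro v
    rw [Finsupp.linearCombination_apply, Finsupp.sum_of_support_subset ψ
      (s := hE.toFinset) (by simpa [← Finset.coe_subset] using hψ) _ (by simp),
      Fintype.sum_prod_type, Finsupp.finsetSum_apply,
      Finset.sum_subtype (p := (· ∈ E(G.toGraph))) _ (by simp)]
    refine Finset.sum_congr rfl fun e _ => ?_
    simp only [Bidirection.incidence, e.2, dif_pos, Fintype.sum_bool, Finsupp.smul_apply,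
      Finsupp.add_apply, Finsupp.single_apply, smul_eq_mul, mul_comm (ψ e), add_mul, ite_mul,
      zero_mul]
  have hdiff : ∀ v, (∑ᶠ h ∈ B.incoming v, ψ h.1) - ∑ᶠ h ∈ B.outgoing v, ψ h.1 =
      Finsupp.linearCombination ℤ B.incidence ψ v := by
    intro v
    rw [hbd, finsum_mem_def, finsum_mem_def, finsum_eq_sum_of_fintype, finsum_eq_sum_of_fintype,
      ← Finset.sum_sub_distrib]
    refine Finset.sum_congr rfl fun h _ => ?_
    rcases Int.units_eq_one_or (B.dir h) with hd | hd <;> by_cases hv : B.halfEnd h = v <;>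
      simp [Set.indicator, Bidirection.incoming, Bidirection.outgoing, hd, hv]
  constructor
  · intro h
    ext v
    by_cases hv : v ∈ V(G.toGraph)
    · rw [← hdiff, h v hv, sub_self, Finsupp.zero_apply]
    · rw [hbd, Finsupp.zero_apply]
      refine Finset.sum_eq_zero fun h _ => if_neg ?_
      rintro rfl
      obtain ⟨e, _ | _⟩ := h
      · exact hv (B.isLink_halfEnd e).left_mem
      · exact hv (B.isLink_halfEnd e).right_mem
  · intro h v _
    rw [← sub_eq_zero, hdiff, h, Finsupp.zero_apply]

end

theorem mainTheorem2 {α β : Type*} (G : SignedGraph α β) (hE : E(G.toGraph).Finite) :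
    G.HasNowhereZeroFlow ℤ ↔
      ∀ e ∈ E(G.toGraph), ∃ C : Graph α β,
        e ∈ E(C) ∧ (G.IsBalancedCircuit C ∨ G.IsUnbalancedBicircuit C) := by
  classical
  constructor
  · rintro ⟨B, φ, hφ, hne⟩ e he
    let ψ : β →₀ ℤ := Finsupp.onFinset hE.toFinset
      (fun f => if h : f ∈ E(G.toGraph) then φ ⟨f, h⟩ else 0)
      (fun f hf => by
        rw [Set.Finite.mem_toFinset]
        by_contra h
        exact hf (dif_neg h))
    have hψφ : ∀ f : E(G.toGraph), ψ f = φ f := fun f => by simp [ψ]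
    have hψS : (ψ.support : Set β) ⊆ E(G.toGraph) := fun f hf => by
      simpa using Finsupp.support_onFinset_subset hf
    refine SignedGraph.IsCycle.exists_mem B.isIncidence (φ := ψ)
      ⟨(B.isFlow_iff hE ψ hψS).1 ?_, hψS⟩ ?_
    · rwa [funext hψφ]
    · rw [Finsupp.mem_support_iff, hψφ ⟨e, he⟩]
      exact hne _
  · intro h
    obtain ⟨B⟩ := G.nonempty_bidirection
    obtain ⟨φ, hφ, hsub⟩ := SignedGraph.exists_cycle_subset_support (G := G) (D := B.incidence)
      hE.toFinset fun f hf => by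
        obtain ⟨C, hfC, hC⟩ := h f (by simpa using hf)
        have hle : C ≤ G.toGraph := hC.elim (·.1) fun h => h.elim (·.1) (·.1)
        obtain ⟨φ, hφ, hb⟩ := hC.elim (fun h => h.exists_cycle B.isIncidence)
          fun h => h.exists_cycle B.isIncidence
        exact ⟨φ, ⟨hb, hφ ▸ hle.edgeSet_mono⟩, by rwa [← Finset.mem_coe, hφ]⟩
    exact ⟨B, fun e => φ e, (B.isFlow_iff hE φ hφ.2).2 hφ.1,
      fun e => Finsupp.mem_support_iff.1 (hsub (by simp))⟩
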